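/- Let $K$ be a field and $G$ a finite group. For a finite separable extension $L/L_0$ of fields containing $K$, say that $L/L_0$ is *defined over* a field $E_0$ with $K\subseteq E_0\subseteq L_0$ if there is a field $E$ with $E_0\subseteq E\subseteq L$, $[E:E_0]=[L:L_0]$ and $L=E\,L_0$; the *essential dimension* $\mathrm{ed}_K(L/L_0)$ is the minimum of $\mathrm{trdeg}_K E_0$ over all such $E_0$. For a finite-dimensional representation $G\to GL(V)$ over $K$, let $K(V)$ be the function field of the affine space $V$, that is, the rational function field $K(x_1,\dots,x_n)$, where $x_1,\dots,x_n$ is a basis of the dual space $V^*$, with the induced action of $G$. The essential dimension of $G$ over $K$ is $\mathrm{ed}_K(G)=\mathrm{ed}_K\bigl(K(V)/K(V)^G\bigr)$, where $V$ is a faithful representation of $G$; to fix a choice, take $V$ to be the regular representation. **Proposition 5.10.** Let $p$ be a prime number, let $K$ be a field of characteristic $p$, and let $r$ be a positive integer. Then $$\mathrm{ed}_K\bigl((\mathbb{Z}/p\mathbb{Z})^r\bigr)=1\quad\text{if and only if}\quad [K:\mathbb{F}_p]\ge r,$$ where $[K:\mathbb{F}_p]$ denotes the (possibly infinite) dimension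 of $K$ as a vector space over $\mathbb{F}_p$. The same holds when the essential dimension is computed from any other faithful representation: for every faithful finite-dimensional representation $V$ of $G=(\mathbb{Z}/p\mathbb{Z})^r$ over $K$, $\mathrm{ed}_K\bigl(K(V)/K(V)^G\bigr)=1$ if and only if $[K:\mathbb{F}_p]\ge r$. -/

import Mathlib

noncomputable section EssentialDimension

universe u v w

/-- For fields `K ⊆ L₀ ⊆ L` with `L / L₀` finite: the extension `L / L₀` is *defined over* the
intermediate field `E₀` (`K ⊆ E₀ ⊆ L₀`) if there is an intermediate field `E` of `L / E₀` such that
`[E : E₀] = [L : L₀]` and `L = E L₀`. -/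
def IsDefinedOver {K : Type u} {L : Type v} [Field K] [Field L] [Algebra K L]
    (L₀ E₀ : IntermediateField K L) : Prop :=
  E₀ ≤ L₀ ∧ ∃ E : IntermediateField K L, E₀ ≤ E ∧
    IntermediateField.relfinrank E₀ E = Module.finrank L₀ L ∧ E ⊔ L₀ = ⊤

/-- The essential dimension `ed_K(L / L₀)` of a finite separable extension `L / L₀` of fields
containing `K`: the minimum of `trdeg_K E₀`, where `E₀` runs through the fields over which `L / L₀`
is defined. (The minimum is over a nonempty set of cardinals, as `L / L₀` is defined
over `L₀`.) -/
def extensionEssDim {K : Type u} {L : Type v} [Field K] [Field L] [Algebra K L]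
    (L₀ : IntermediateField K L) : Cardinal.{v} :=
  sInf {d | ∃ E₀ : IntermediateField K L, IsDefinedOver L₀ E₀ ∧ d = Algebra.trdeg K E₀}

/-- `L / L₀` is defined over `L₀`, so the minimum above is over a nonempty set. -/
theorem isDefinedOver_self {K : Type u} {L : Type v} [Field K] [Field L] [Algebra K L]
    (L₀ : IntermediateField K L) : IsDefinedOver L₀ L₀ :=
  ⟨le_rfl, ⊤, le_top, IntermediateField.relfinrank_top_right L₀, by simp⟩

/-- The coordinate ring `K[V] = Sym(V*)` of the affine space attached to a vector space `V`; a basis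
`x₁, …, xₙ` of the dual space identifies it with the polynomial ring `K[x₁, …, xₙ]`. -/
abbrev CoordRing (K : Type u) (V : Type v) [Field K] [AddCommGroup V] [Module K V] :
    Type (max u v) :=
  SymmetricAlgebra K (Module.Dual K V)

/-- The function field `K(V) = Frac K[V]` of the affine space attached to `V`. -/
abbrev FunField (K : Type u) (V : Type v) [Field K] [AddCommGroup V] [Module K V] :
    Type (max u v) :=
  FractionRing (CoordRing K V)

namespace Representation

variable {K : Type u} {G : Type w} {V : Type v} [Field K] [Group G] [AddCommGroup V] [Module K V]

/-- The endomorphism of `K[V]` induced by `g`: it extends the action of `g` on the dual space,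
which is `(g • f) x = f (g⁻¹ • x)`. -/
def coordRingHom (ρ : Representation K G V) (g : G) : CoordRing K V →ₐ[K] CoordRing K V :=
  SymmetricAlgebra.lift (SymmetricAlgebra.ι K (Module.Dual K V) ∘ₗ ρ.dual g)

@[simp]
theorem coordRingHom_ι (ρ : Representation K G V) (g : G) (f : Module.Dual K V) :
    ρ.coordRingHom g (SymmetricAlgebra.ι K _ f) = SymmetricAlgebra.ι K _ (ρ.dual g f) := by
  simp [coordRingHom]

theorem coordRingHom_one (ρ : Representation K G V) : ρ.coordRingHom 1 = AlgHom.id K _ := by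
  apply SymmetricAlgebra.algHom_ext
  refine LinearMap.ext fun f ↦ ?_
  change ρ.coordRingHom 1 (SymmetricAlgebra.ι K _ f) = SymmetricAlgebra.ι K _ f
  rw [coordRingHom_ι, map_one, Module.End.one_apply]

theorem coordRingHom_mul (ρ : Representation K G V) (g h : G) :
    ρ.coordRingHom (g * h) = (ρ.coordRingHom g).comp (ρ.coordRingHom h) := by
  apply SymmetricAlgebra.algHom_ext
  refine LinearMap.ext fun f ↦ ?_
  change ρ.coordRingHom (g * h) (SymmetricAlgebra.ι K _ f) =
    ρ.coordRingHom g (ρ.coordRingHom h (SymmetricAlgebra.ι K _ f))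
  rw [coordRingHom_ι, coordRingHom_ι, coordRingHom_ι, map_mul, Module.End.mul_apply]

/-- The action of `G` on `K[V]` by `K`-algebra automorphisms. -/
def coordRingAction (ρ : Representation K G V) : G →* (CoordRing K V ≃ₐ[K] CoordRing K V) where
  toFun g := AlgEquiv.ofAlgHom (ρ.coordRingHom g) (ρ.coordRingHom g⁻¹)
    (by rw [← coordRingHom_mul, mul_inv_cancel, coordRingHom_one])
    (by rw [← coordRingHom_mul, inv_mul_cancel, coordRingHom_one])
  map_one' := by ext x; exact DFunLike.congr_fun ρ.coordRingHom_one x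
  map_mul' g h := by ext x; exact DFunLike.congr_fun (ρ.coordRingHom_mul g h) x

/-- The action of `G` on `K(V)` by `K`-automorphisms. -/
def funFieldAction (ρ : Representation K G V) : G →* (FunField K V ≃ₐ[K] FunField K V) :=
  (IsFractionRing.fieldEquivOfAlgEquivHom K (FunField K V)).comp ρ.coordRingAction

/-- The fixed field `K(V)^G`. -/
def invariantField (ρ : Representation K G V) : IntermediateField K (FunField K V) :=
  IntermediateField.fixedField ρ.funFieldAction.range

/-- The essential dimension `ed_K(K(V) / K(V)^G)` attached to a representation of `G` on `V`. -/
def essDim (ρ : Representation K G V) : Cardinal.{max u v} :=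
  extensionEssDim ρ.invariantField

end Representation

/-- The essential dimension `ed_K(G)` of a finite group `G`, that is `ed_K(K(V) / K(V)^G)` for a
faithful representation of `G` on `V`; here `V` is the regular representation. -/
def groupEssDim (K : Type u) [Field K] (G : Type w) [Group G] : Cardinal.{max u w} :=
  (Representation.leftRegular K G).essDim

end EssentialDimension

/-! Write `L = K(V)` and let `G` act faithfully on it. If `[K : F_p] ≥ r`, then `G` embeds in the
additive group of `K` by some `a`, and additive Hilbert 90 (`exists_translate`) gives `f` in `L`
with `g f = f + a(g)`. The action on `K(f)` is then already faithful, so `L / L^G` is defined over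
`K(f) ∩ L^G`, of transcendence degree at most one. Degree zero is impossible: elements of `L`
algebraic over `K` are constants, on which `G` acts trivially (`one_le_essDim`).

Conversely, if `[K : F_p] < r`, then `K` is finite. Suppose `L / L^G` is defined over `E₀` of
transcendence degree one. The algebraic closure of `E₀` in `L` is `G`-stable, and `G` acts
faithfully on it (`IsDefinedOver.card_dvd`). A specialization of `K[V]` to a curve embeds this
closure in `K(X)` (`exists_algHom_ratFunc`), so by Lüroth it is isomorphic to `K(X)`, whose
automorphism group is a quotient of `GL₂(K)`. Hence `p ^ r` divides `|GL₂(K)|`, whose `p`-part is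
`|K|`; this forces `r ≤ [K : F_p]`. -/

/-! ### Automorphisms of `K(X)`. -/

theorem RatFunc.algHom_ext_X {K : Type*} [Field K] {S : Type*} [Field S] [Algebra K S]
    {f g : RatFunc K →ₐ[K] S} (h : f RatFunc.X = g RatFunc.X) : f = g := by
  apply IsLocalization.algHom_ext (nonZeroDivisors (Polynomial K))
  apply Polynomial.algHom_ext
  change f (algebraMap _ _ _) = g (algebraMap _ _ _)
  simpa using h

namespace RatFunc

variable {K : Type*} [Field K]

theorem C_mul_X_add_C_eq_zero {a b : K} : C a * X + C b = (0 : RatFunc K) ↔ a = 0 ∧ b = 0 := by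
  constructor
  · intro h
    have h' : Polynomial.C a * Polynomial.X + Polynomial.C b = 0 := by
      apply RatFunc.algebraMap_injective K
      simpa using h
    constructor
    · simpa using congrArg (fun q ↦ q.coeff 1) h'
    · simpa using congrArg (fun q ↦ q.coeff 0) h'
  · rintro ⟨rfl, rfl⟩
    simp

/-- The `K`-endomorphism of `K(X)` that sends `X` to a transcendental element `u`. -/
noncomputable def evalAlgHom (u : RatFunc K) (hu : Transcendental K u) :
    RatFunc K →ₐ[K] RatFunc K :=
  (IntermediateField.val _).comp (algEquivOfTranscendental u hu).toAlgHom

@[simp]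
theorem evalAlgHom_X (u : RatFunc K) (hu : Transcendental K u) : evalAlgHom u hu X = u := by
  simp [evalAlgHom]

/-- The linear fractional transformation of `X` attached to an invertible matrix. -/
noncomputable def moebius (A : GL (Fin 2) K) : RatFunc K :=
  (C (A 0 0) * X + C (A 1 0)) / (C (A 0 1) * X + C (A 1 1))

theorem moebius_denom_ne_zero (A : GL (Fin 2) K) : C (A 0 1) * X + C (A 1 1) ≠ (0 : RatFunc K) := by
  rw [Ne, C_mul_X_add_C_eq_zero]
  rintro ⟨h1, h2⟩
  have := A.det.ne_zero
  simp [Matrix.det_fin_two, h1, h2] at this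

theorem transcendental_moebius (A : GL (Fin 2) K) : Transcendental K (moebius A) := by
  apply transcendental_of_ne_C
  rintro ⟨c, hc⟩
  rw [moebius, div_eq_iff (moebius_denom_ne_zero A)] at hc
  have h : C (A 0 0 - c * A 0 1) * X + C (A 1 0 - c * A 1 1) = (0 : RatFunc K) := by
    simp only [map_sub, map_mul]
    linear_combination hc
  obtain ⟨h1, h2⟩ := C_mul_X_add_C_eq_zero.mp h
  have := A.det.ne_zero
  apply this
  rw [Matrix.GeneralLinearGroup.val_det_apply, Matrix.det_fin_two]
  linear_combination (A 1 1) * h1 - A 0 1 * h2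

/-- The action of `GL₂(K)` on `K(X)` by linear fractional transformations of `X`. -/
noncomputable def moebiusHom (K : Type*) [Field K] :
    GL (Fin 2) K →* (RatFunc K →ₐ[K] RatFunc K) where
  toFun A := evalAlgHom (moebius A) (transcendental_moebius A)
  map_one' := by
    apply algHom_ext_X
    simp [moebius]
  -- Composing substitutions reverses the matrix product; `moebius` reads `A` by columns to restore
  -- the order.
  map_mul' A B := by
    apply algHom_ext_X
    have hC : ∀ (σ : RatFunc K →ₐ[K] RatFunc K) (c : K), σ (C c) = C c := fun σ c ↦ σ.commutes c
    have hA := moebius_denom_ne_zero A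
    have hAB := moebius_denom_ne_zero (A * B)
    rw [AlgHom.mul_apply, evalAlgHom_X, evalAlgHom_X]
    have hd : evalAlgHom (moebius A) (transcendental_moebius A) (C (B 0 1) * X + C (B 1 1)) ≠ 0 :=
      (map_ne_zero _).mpr (moebius_denom_ne_zero B)
    nth_rw 3 [moebius]
    rw [map_div₀, eq_div_iff hd]
    simp only [map_add, map_mul, hC, evalAlgHom_X, moebius]
    simp only [Units.val_mul, Matrix.mul_apply, Fin.sum_univ_two, map_add, map_mul] at hAB ⊢
    rw [div_mul_eq_mul_div, div_eq_iff hAB]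
    field_simp
    ring

/-- The image of `X` generates `K(X)`, and the degree of `K(X)` over `K(u)` is the larger of the
degrees of numerator and denominator of `u`; so both are at most one. -/
theorem exists_moebius_eq (σ : RatFunc K ≃ₐ[K] RatFunc K) : ∃ A : GL (Fin 2) K, σ X = moebius A := by
  set u := σ X with hu
  have hnC : ¬ ∃ c, u = C c := by
    rintro ⟨c, hc⟩
    have : X = C c := σ.injective (hc.trans (σ.commutes c).symm)
    have h : C (1 : K) * X + C (-c) = (0 : RatFunc K) := by simp [this]
    simpa using (C_mul_X_add_C_eq_zero.mp h).1
  have htop : IntermediateField.adjoin K {u} = ⊤ := by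
    have := congrArg (IntermediateField.map σ.toAlgHom) (RatFunc.adjoin_X (K := K))
    rw [IntermediateField.adjoin_map] at this
    simpa [← AlgHom.fieldRange_eq_map] using this
  have hdeg := finrank_eq_max_natDegree u
  rw [htop, IntermediateField.finrank_top] at hdeg
  have hn : u.num.natDegree ≤ 1 := by omega
  have hd : u.denom.natDegree ≤ 1 := by omega
  have hun : algebraMap _ (RatFunc K) u.num = C (u.num.coeff 1) * X + C (u.num.coeff 0) := by
    conv_lhs => rw [Polynomial.eq_X_add_C_of_natDegree_le_one hn]
    simp
  have hud : algebraMap _ (RatFunc K) u.denom = C (u.denom.coeff 1) * X + C (u.denom.coeff 0) := by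
    conv_lhs => rw [Polynomial.eq_X_add_C_of_natDegree_le_one hd]
    simp
  have hq := RatFunc.num_div_denom u
  have hd0 : algebraMap _ (RatFunc K) u.denom ≠ 0 := by
    simpa using RatFunc.denom_ne_zero u
  rw [hun, hud] at hq
  rw [hud] at hd0
  generalize u.num.coeff 1 = a, u.num.coeff 0 = c, u.denom.coeff 1 = b, u.denom.coeff 0 = d at *
  -- A zero determinant makes numerator and denominator proportional, so `u` would be constant.
  have hdet : a * d - b * c ≠ 0 := by
    intro hdet
    apply hnC
    by_cases hb : b = 0
    · have hd : d ≠ 0 := by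
        rintro rfl
        simp [hb] at hd0
      refine ⟨c / d, ?_⟩
      rw [← hq, div_eq_iff hd0]
      obtain rfl : a = 0 := by simpa [hb, hd] using hdet
      subst hb
      rw [map_zero, zero_mul, zero_add, zero_add, ← map_mul, div_mul_cancel₀ _ hd]
    · refine ⟨a / b, ?_⟩
      rw [← hq, div_eq_iff hd0, mul_add, ← mul_assoc, ← map_mul, ← map_mul, div_mul_cancel₀ _ hb]
      congr 2
      field_simp
      linear_combination -hdet
  refine ⟨Matrix.GeneralLinearGroup.mkOfDetNeZero !![a, b; c, d] ?_, ?_⟩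
  · simpa [Matrix.det_fin_two] using hdet
  · simp [moebius, Matrix.GeneralLinearGroup.mkOfDetNeZero, hq]

theorem card_algEquiv_dvd (K : Type*) [Field K] :
    Nat.card (RatFunc K ≃ₐ[K] RatFunc K) ∣ Nat.card (GL (Fin 2) K) := by
  refine Subgroup.card_dvd_of_surjective
    ((AlgEquiv.algHomUnitsEquiv K (RatFunc K)).toMonoidHom.comp (moebiusHom K).toHomUnits)
    fun σ ↦ ?_
  obtain ⟨A, hA⟩ := exists_moebius_eq σ
  refine ⟨A, ?_⟩
  apply AlgEquiv.coe_toAlgHom_injective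
  apply algHom_ext_X
  refine Eq.trans ?_ hA.symm
  exact evalAlgHom_X _ (transcendental_moebius A)

end RatFunc

/-! ### Rationality of subfields of transcendence degree one. -/

/-- `K[X]` is an infinite domain even when `K` is finite, so a nonzero polynomial cannot vanish at
all its `K[X]`-valued points. -/
theorem MvPolynomial.exists_aeval_polynomial_ne_zero {σ K : Type*} [Field K]
    {h : MvPolynomial σ K} (hh : h ≠ 0) :
    ∃ c : MvPolynomial σ K →ₐ[K] Polynomial K, c h ≠ 0 := by
  by_contra! H
  apply hh
  apply MvPolynomial.map_injective (Polynomial.C (R := K)) Polynomial.C_injective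
  rw [map_zero]
  apply MvPolynomial.funext
  intro x
  rw [MvPolynomial.eval_map, map_zero]
  exact H (MvPolynomial.aeval x)

/-- Over a finite field `K`, a field of transcendence degree one inside the fraction field of an
integrally closed `K`-algebra `R` with enough `K[X]`-valued points embeds into `K(X)`. -/
theorem exists_algHom_ratFunc {K R L : Type*} [Field K] [Finite K] [CommRing R] [IsDomain R]
    [IsIntegrallyClosed R] [Algebra K R] [Field L] [Algebra R L] [IsFractionRing R L] [Algebra K L]
    [IsScalarTower K R L]
    (hR : ∀ h : R, h ≠ 0 → ∃ c : R →ₐ[K] Polynomial K, c h ≠ 0)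
    (E : IntermediateField K L) (f : L) (hf : Transcendental K f)
    (hE : ∀ e ∈ E, IsAlgebraic (Algebra.adjoin K {f}) e) :
    Nonempty (E →ₐ[K] RatFunc K) := by
  have := Fintype.ofFinite K
  obtain ⟨P, Q, hQ, hPQ⟩ := IsFractionRing.div_surjective (A := R) f
  have hQ0 : algebraMap R L Q ≠ 0 := by
    simpa using nonZeroDivisors.ne_zero hQ
  -- The specialization must keep `f = P / Q` defined and different from every constant `a`. As `K`
  -- is finite, these conditions amount to the nonvanishing of a single product.
  obtain ⟨c, hc⟩ := hR (Q * ∏ a : K, (P - algebraMap K R a * Q)) <| by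
    refine mul_ne_zero (nonZeroDivisors.ne_zero hQ) (Finset.prod_ne_zero_iff.mpr fun a _ h ↦ hf ?_)
    have : f = algebraMap K L a := by
      rw [← hPQ, div_eq_iff hQ0, IsScalarTower.algebraMap_apply K R L, ← map_mul,
        sub_eq_zero.mp h]
    exact this ▸ isAlgebraic_algebraMap a
  rw [map_mul, map_prod, mul_ne_zero_iff, Finset.prod_ne_zero_iff] at hc
  obtain ⟨hcQ, hcP⟩ := hc
  let 𝔭 : Ideal R := RingHom.ker c
  have h𝔭 : 𝔭.IsPrime := RingHom.ker_isPrime _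
  have hM : 𝔭.primeCompl ≤ nonZeroDivisors R := 𝔭.primeCompl_le_nonZeroDivisors
  let A : Subalgebra R L := Localization.subalgebra.ofField L 𝔭.primeCompl hM
  have hloc : IsLocalization 𝔭.primeCompl A := Localization.subalgebra.isLocalization_ofField ..
  have hfrac : IsFractionRing A L := Localization.subalgebra.isFractionRing_ofField ..
  have hic : IsIntegrallyClosed A := isIntegrallyClosed_of_isLocalization A 𝔭.primeCompl hM
  let ψ : R →+* RatFunc K := (algebraMap (Polynomial K) (RatFunc K)).comp (c : R →+* Polynomial K)
  have hψ : ∀ x : R, ψ x = 0 ↔ x ∈ 𝔭 := fun x ↦ by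
    simp [ψ, 𝔭, RingHom.mem_ker]
  let φ : A →+* RatFunc K := IsLocalization.lift (M := 𝔭.primeCompl) (g := ψ) fun y ↦
    isUnit_iff_ne_zero.mpr fun h ↦ y.2 ((hψ _).mp h)
  have hφR : ∀ x : R, φ (algebraMap R A x) = ψ x := fun x ↦ IsLocalization.lift_eq _ x
  have hφK : ∀ a : K, φ (algebraMap K A a) = algebraMap K (RatFunc K) a := fun a ↦ by
    rw [IsScalarTower.algebraMap_apply K R A, hφR]
    simp [ψ]
  have hunit : ∀ x : A, φ x ≠ 0 → IsUnit x := by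
    intro x hx
    obtain ⟨y, s, rfl⟩ := IsLocalization.exists_mk'_eq 𝔭.primeCompl x
    rw [IsLocalization.AtPrime.isUnit_mk'_iff A 𝔭]
    intro hy
    apply hx
    rw [IsLocalization.lift_mk', (hψ y).mpr hy, zero_mul]
  let φ' : A →ₐ[K] RatFunc K := ⟨φ, hφK⟩
  have hQ𝔭 : Q ∈ 𝔭.primeCompl := fun h ↦ hcQ h
  have hfA : f ∈ A := ⟨P, Q, hQ𝔭, by rw [← hPQ, div_eq_mul_inv]⟩
  have hφf : Transcendental K (φ' ⟨f, hfA⟩) := by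
    apply RatFunc.transcendental_of_ne_C
    rintro ⟨a, ha⟩
    apply hcP a (Finset.mem_univ a)
    have h1 : (⟨f, hfA⟩ : A) * algebraMap R A Q = algebraMap R A P := by
      apply Subtype.ext
      change f * algebraMap R L Q = algebraMap R L P
      rw [← hPQ, div_mul_cancel₀ _ hQ0]
    have h2 := congrArg φ h1
    rw [map_mul, hφR, hφR] at h2
    change φ' ⟨f, hfA⟩ * _ = _ at h2
    rw [ha] at h2
    apply RatFunc.algebraMap_injective K
    rw [map_zero, map_sub, map_mul, map_sub, AlgHom.commutes, map_mul]
    rw [sub_eq_zero]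
    exact h2.symm
  let B := Algebra.adjoin K {f}
  have hBA : B ≤ A.restrictScalars K := Algebra.adjoin_le (by simpa using hfA)
  -- Some nonzero `y = s(f)` makes `y e` integral over `K[f]`, hence an element of the integrally
  -- closed local ring `A`. The image of `f` is transcendental, so `s(f)` has nonzero image and is a
  -- unit of `A`; thus `e` lies in `A`.
  have hEA : ∀ e ∈ E, e ∈ A := by
    intro e he
    obtain ⟨y, hy0, hy⟩ := (hE e he).exists_integral_multiple
    let : Algebra B A := (Subalgebra.inclusion hBA).toRingHom.toAlgebra
    have : IsScalarTower B A L := IsScalarTower.of_algebraMap_eq fun _ ↦ rfl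
    have hint : IsIntegral A (y • e) := hy.tower_top
    obtain ⟨z, hz⟩ := IsIntegrallyClosed.isIntegral_iff.mp hint
    obtain ⟨s, hs⟩ := (Algebra.adjoin_singleton_eq_range_aeval K f ▸ y.2 :
      (y : L) ∈ (Polynomial.aeval (R := K) f).range)
    have hs0 : s ≠ 0 := by
      rintro rfl
      exact hy0 (Subtype.ext (by simpa using hs.symm))
    have hsA : ((Polynomial.aeval (⟨f, hfA⟩ : A) s : A) : L) = y := by
      rw [← hs]
      exact (Polynomial.aeval_algHom_apply (A.val.restrictScalars K) (⟨f, hfA⟩ : A) s).symm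
    obtain ⟨u, hu⟩ := hunit (Polynomial.aeval (⟨f, hfA⟩ : A) s) <| by
      change φ' _ ≠ 0
      rw [← Polynomial.aeval_algHom_apply]
      exact fun h ↦ hs0 (transcendental_iff.mp hφf s h)
    have : e = ((↑u⁻¹ * z : A) : L) := by
      have hyL : (y : L) ≠ 0 := fun h ↦ hy0 (Subtype.ext h)
      have h1 : ((↑u⁻¹ : A) : L) * y = 1 := by
        rw [← hsA, ← hu]
        exact congrArg Subtype.val u.inv_mul
      have h2 : (z : L) = y * e := hz
      change e = ((↑u⁻¹ : A) : L) * (z : L)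
      rw [h2, ← mul_assoc, h1, one_mul]
    exact this ▸ SetLike.coe_mem _
  exact ⟨φ'.comp (Subalgebra.inclusion (S := E.toSubalgebra) (T := A.restrictScalars K) hEA)⟩

/-- Over a finite field `K`, a field of transcendence degree one inside the fraction field of an
integrally closed `K`-algebra with enough `K[X]`-valued points is rational. -/
theorem exists_algEquiv_ratFunc {K R L : Type*} [Field K] [Finite K] [CommRing R] [IsDomain R]
    [IsIntegrallyClosed R] [Algebra K R] [Field L] [Algebra R L] [IsFractionRing R L] [Algebra K L]
    [IsScalarTower K R L]
    (hR : ∀ h : R, h ≠ 0 → ∃ c : R →ₐ[K] Polynomial K, c h ≠ 0)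
    (E : IntermediateField K L) (f : L) (hf : Transcendental K f) (hfE : f ∈ E)
    (hE : ∀ e ∈ E, IsAlgebraic (Algebra.adjoin K {f}) e) :
    Nonempty (E ≃ₐ[K] RatFunc K) := by
  obtain ⟨j⟩ := exists_algHom_ratFunc hR E f hf hE
  -- Lüroth's theorem applies to subfields larger than `K`; the image of `f` shows that this is one.
  have hbot : j.fieldRange ≠ ⊥ := by
    intro h
    have hj : j ⟨f, hfE⟩ ∈ j.fieldRange := ⟨_, rfl⟩
    rw [h, IntermediateField.mem_bot] at hj
    obtain ⟨a, ha⟩ := hj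
    have h1 : (⟨f, hfE⟩ : E) = algebraMap K E a :=
      j.injective (ha.symm.trans (j.commutes a).symm)
    have h2 : f = algebraMap K L a := congrArg Subtype.val h1
    exact hf (h2 ▸ isAlgebraic_algebraMap a)
  exact ⟨(AlgEquiv.ofInjectiveField j).trans (RatFunc.Luroth.algEquiv hbot).symm⟩

/-- A nonzero element integral over a field is a unit, and the units of a polynomial ring over a
field are constants. -/
theorem MvPolynomial.exists_eq_C_of_isAlgebraic {σ K : Type*} [Field K] {h : MvPolynomial σ K}
    (hh : IsAlgebraic K h) : ∃ a, h = MvPolynomial.C a := by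
  by_cases h0 : h = 0
  · exact ⟨0, by simp [h0]⟩
  obtain ⟨a, -, ha⟩ := MvPolynomial.isUnit_iff_eq_C_of_isReduced.mp
    (hh.isIntegral.isUnit h0)
  exact ⟨a, ha⟩

open IntermediateField in
theorem IntermediateField.trdeg_adjoin_simple_le {K L : Type*} [Field K] [Field L] [Algebra K L]
    (f : L) : Algebra.trdeg K K⟮f⟯ ≤ 1 := by
  have : Algebra.IsAlgebraic (Algebra.adjoin K {AdjoinSimple.gen K f}) K⟮f⟯ := by
    refine ⟨fun x ↦ ?_⟩
    obtain ⟨p, q, hx⟩ := (mem_adjoin_simple_iff K _).mp x.2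
    have hx' : x = Polynomial.aeval (AdjoinSimple.gen K f) p /
        Polynomial.aeval (AdjoinSimple.gen K f) q := by
      apply Subtype.ext
      rw [hx]
      simp
    have h (s : Polynomial K) : IsAlgebraic (Algebra.adjoin K {AdjoinSimple.gen K f})
        (Polynomial.aeval (AdjoinSimple.gen K f) s) :=
      isAlgebraic_algebraMap (A := K⟮f⟯) (⟨_, Polynomial.aeval_mem_adjoin_singleton K _⟩ :
        Algebra.adjoin K {AdjoinSimple.gen K f})
    rw [hx', div_eq_mul_inv]
    exact (h p).mul (h q).inv
  simpa using Algebra.IsAlgebraic.trdeg_le_cardinalMk K ({AdjoinSimple.gen K f} : Set K⟮f⟯)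

theorem Algebra.exists_isAlgebraic_adjoin_of_trdeg_eq_one {K F : Type*} [Field K] [Field F]
    [Algebra K F] (h : Algebra.trdeg K F = 1) :
    ∃ f : F, Transcendental K f ∧ Algebra.IsAlgebraic (Algebra.adjoin K {f}) F := by
  obtain ⟨s, hs⟩ := exists_isTranscendenceBasis K F
  have hcard := hs.cardinalMk_eq_trdeg
  rw [h, Cardinal.mk_set_eq_one_iff] at hcard
  obtain ⟨f, rfl⟩ := hcard
  have halg := hs.isAlgebraic
  rw [Subtype.range_coe] at halg
  exact ⟨f, hs.1.transcendental (⟨f, rfl⟩ : ({f} : Set F)), halg⟩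

theorem IsAlgebraic.adjoin_algebraMap {K F L : Type*} [Field K] [Field F] [Field L] [Algebra K F]
    [Algebra F L] [Algebra K L] [IsScalarTower K F L] {f : F}
    [Algebra.IsAlgebraic (Algebra.adjoin K {f}) F] {e : L} (he : IsAlgebraic F e) :
    IsAlgebraic (Algebra.adjoin K {algebraMap F L f}) e := by
  have h1 : IsAlgebraic (Algebra.adjoin K {f}) e := he.restrictScalars _
  have hmem : ∀ x : Algebra.adjoin K {f},
      algebraMap F L x ∈ Algebra.adjoin K {algebraMap F L f} := by
    intro x
    have : IsScalarTower.toAlgHom K F L x ∈ (Algebra.adjoin K {f}).map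
      (IsScalarTower.toAlgHom K F L) := ⟨x, x.2, rfl⟩
    rw [AlgHom.map_adjoin_singleton] at this
    exact this
  refine h1.ringHom_of_comp_eq (g := RingHom.id L) (((algebraMap F L).comp
    (algebraMap (Algebra.adjoin K {f}) F)).codRestrict (Algebra.adjoin K {algebraMap F L f}) hmem)
    ?_ rfl
  intro x y hxy
  exact Subtype.ext ((algebraMap F L).injective (congrArg Subtype.val hxy))

/-- Over a finite field `K`, the algebraic closure of a field of transcendence degree one inside the
fraction field of an integrally closed `K`-algebra with enough `K[X]`-valued points is rational. -/
theorem exists_algebraicClosure_algEquiv_ratFunc {K R L : Type*} [Field K] [Finite K] [CommRing R]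
    [IsDomain R] [IsIntegrallyClosed R] [Algebra K R] [Field L] [Algebra R L] [IsFractionRing R L]
    [Algebra K L] [IsScalarTower K R L]
    (hR : ∀ h : R, h ≠ 0 → ∃ c : R →ₐ[K] Polynomial K, c h ≠ 0)
    (E₀ : IntermediateField K L) (hE₀ : Algebra.trdeg K E₀ = 1) :
    Nonempty ((algebraicClosure E₀ L).restrictScalars K ≃ₐ[K] RatFunc K) := by
  obtain ⟨f, hf, halg⟩ := Algebra.exists_isAlgebraic_adjoin_of_trdeg_eq_one hE₀
  exact exists_algEquiv_ratFunc hR _ (algebraMap E₀ L f)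
    ((transcendental_algebraMap_iff (algebraMap E₀ L).injective).mpr hf)
    (mem_algebraicClosure_iff.mpr (isAlgebraic_algebraMap f))
    fun x hx ↦ IsAlgebraic.adjoin_algebraMap (mem_algebraicClosure_iff.mp hx)

/-! ### Finite groups of field automorphisms. -/

section FiniteGroup

open IntermediateField Polynomial

variable {K L G : Type*} [Field K] [Field L] [Algebra K L] [Group G]
  {φ : G →* (L ≃ₐ[K] L)}

theorem mem_fixedField_range_iff {x : L} : x ∈ fixedField φ.range ↔ ∀ g, φ g x = x := by
  simp

theorem card_range_eq (hφ : Function.Injective φ) : Nat.card φ.range = Nat.card G :=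
  (Nat.card_congr (MonoidHom.ofInjective hφ).toEquiv).symm

variable [Finite G]

theorem finrank_fixedField_range (hφ : Function.Injective φ) :
    Module.finrank (fixedField φ.range) L = Nat.card G := by
  have : Finite φ.range := Set.finite_range φ
  have := Fintype.ofFinite φ.range
  rw [← card_range_eq hφ, Nat.card_eq_fintype_card]
  exact FixedPoints.finrank_eq_card φ.range L

/-- Additive Hilbert 90: independence of automorphisms gives `x` with nonzero trace `s`, and
averaging `a(g) · g x` against `s` splits the cocycle `a`. -/
theorem exists_translate (hφ : Function.Injective φ) (a : G → K)
    (ha : ∀ g h, a (g * h) = a g + a h) :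
    ∃ f : L, ∀ g, φ g f = f + algebraMap K L (a g) := by
  have := Fintype.ofFinite G
  obtain ⟨x, hx⟩ : ∃ x : L, ∑ g, φ g x ≠ 0 := by
    by_contra! H
    have hli := (linearIndependent_toLinearMap K L L).comp (fun g : G ↦ (φ g).toAlgHom)
      fun g h hgh ↦ hφ (AlgEquiv.coe_toAlgHom_injective hgh)
    have h1 := Fintype.linearIndependent_iff.mp hli (fun _ ↦ 1) (by
      ext x
      simpa using H x) 1
    exact one_ne_zero h1
  set s := ∑ g, φ g x with hs
  have hfix : ∀ h, φ h s = s := by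
    intro h
    rw [hs, map_sum]
    exact Fintype.sum_equiv (Equiv.mulLeft h) _ _ fun g ↦ by simp
  refine ⟨-(∑ g, algebraMap K L (a g) * φ g x) / s, fun h ↦ ?_⟩
  have h1 : φ h (∑ g, algebraMap K L (a g) * φ g x) =
      (∑ g, algebraMap K L (a g) * φ g x) - algebraMap K L (a h) * s := by
    rw [map_sum, hs, Finset.mul_sum, ← Finset.sum_sub_distrib]
    refine Fintype.sum_equiv (Equiv.mulLeft h) _ _ fun g ↦ ?_
    simp [ha]
    ring
  rw [map_div₀, map_neg, hfix, h1]
  field_simp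
  ring

/-- The `|G|` distinct conjugates of `f` are all roots of its minimal polynomial. -/
theorem card_le_natDegree_minpoly (F : IntermediateField K L) (hF : F ≤ fixedField φ.range)
    {f : L} (hf : Function.Injective fun g ↦ φ g f) (hint : IsIntegral F f) :
    Nat.card G ≤ (minpoly F f).natDegree := by
  have := Fintype.ofFinite G
  classical
  rw [Nat.card_eq_fintype_card, ← Finset.card_univ, ← Finset.card_image_of_injective _ hf,
    ← natDegree_map (algebraMap F L)]
  apply card_le_degree_of_subset_roots
  intro y hy
  obtain ⟨g, -, rfl⟩ := Finset.mem_image.mp hy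
  rw [mem_roots ((minpoly.monic hint).map _).ne_zero, IsRoot.def, eval_map_algebraMap]
  let σ : L →ₐ[F] L := ⟨(φ g : L →+* L), fun x ↦ mem_fixedField_range_iff.mp (hF x.2) g⟩
  exact (aeval_algHom_apply σ f (minpoly F f)).trans (by simp)

theorem extensionEssDim_fixedField_le_one (hφ : Function.Injective φ) (a : G → K)
    (ha : ∀ g h, a (g * h) = a g + a h) (hinj : Function.Injective a) :
    extensionEssDim (fixedField φ.range) ≤ 1 := by
  have := Fintype.ofFinite G
  obtain ⟨f, hf⟩ := exists_translate hφ a ha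
  have hfinj : Function.Injective fun g ↦ φ g f := fun g h hgh ↦ by
    simp only [hf] at hgh
    exact hinj ((algebraMap K L).injective (add_left_cancel hgh))
  let L₀ := fixedField φ.range
  let E₀ := K⟮f⟯ ⊓ L₀
  have hE : E₀ ≤ K⟮f⟯ := inf_le_left
  -- The coefficients of `N` are `G`-invariant, and lie in `K(f)` because every conjugate of `f` is
  -- a translate by a constant. So `N` descends to `E₀` and bounds the degree of `f` there.
  let N : L[X] := ∏ g, (X - C (φ g f))
  have hNdeg : N.natDegree = Nat.card G := by
    simp [N, natDegree_prod_of_monic, monic_X_sub_C]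
  have hNmonic : N.Monic := monic_prod_of_monic _ _ fun _ _ ↦ monic_X_sub_C _
  have hNK : ∀ n, N.coeff n ∈ K⟮f⟯ := by
    have hlift : N ∈ lifts (algebraMap K⟮f⟯ L) := by
      refine prod_mem fun g _ ↦ ?_
      refine ⟨X - C (AdjoinSimple.gen K f + algebraMap K _ (a g)), ?_⟩
      simp [hf]
    intro n
    obtain ⟨y, hy⟩ := (lifts_iff_coeff_lifts N).mp hlift n
    exact hy ▸ y.2
  have hNL₀ : ∀ n, N.coeff n ∈ L₀ := by
    intro n
    rw [mem_fixedField_range_iff]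
    intro h
    have : N.map (φ h : L →+* L) = N := by
      simp only [N, Polynomial.map_prod, Polynomial.map_sub, map_X, map_C]
      exact Fintype.prod_equiv (Equiv.mulLeft h) _ _ fun g ↦ by simp
    conv_rhs => rw [← this]
    rw [coeff_map]
    rfl
  obtain ⟨M, hM⟩ : N ∈ lifts (algebraMap E₀ L) :=
    (lifts_iff_coeff_lifts N).mpr fun n ↦ ⟨⟨N.coeff n, hNK n, hNL₀ n⟩, rfl⟩
  change M.map (algebraMap E₀ L) = N at hM
  have hMmonic : M.Monic := monic_of_injective (algebraMap E₀ L).injective (hM ▸ hNmonic)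
  have hMf : aeval f M = 0 := by
    rw [← eval_map_algebraMap, hM, eval_prod]
    exact Finset.prod_eq_zero (Finset.mem_univ 1) (by simp)
  have hint : IsIntegral E₀ f := ⟨M, hMmonic, by rwa [← aeval_def]⟩
  have hdeg : (minpoly E₀ f).natDegree = Nat.card G := by
    refine le_antisymm ?_ (card_le_natDegree_minpoly E₀ inf_le_right hfinj hint)
    rw [← hNdeg, ← hM, natDegree_map]
    exact natDegree_le_natDegree (minpoly.min _ _ hMmonic hMf)
  have hdef : IsDefinedOver L₀ E₀ := by
    refine ⟨inf_le_right, K⟮f⟯, hE, ?_, ?_⟩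
    · rw [relfinrank_eq_finrank_of_le hE, extendScalars_adjoin hE, adjoin.finrank hint, hdeg,
        finrank_fixedField_range hφ]
    · have hfin : FiniteDimensional L₀ L := Module.finite_of_finrank_pos (by
        rw [finrank_fixedField_range hφ]
        exact Nat.card_pos)
      have htop : L₀⟮f⟯ = ⊤ := by
        refine eq_of_le_of_finrank_le le_top ?_
        rw [finrank_top', finrank_fixedField_range hφ,
          adjoin.finrank (Algebra.IsIntegral.isIntegral f)]
        exact card_le_natDegree_minpoly L₀ le_rfl hfinj (Algebra.IsIntegral.isIntegral f)
      have := congrArg (restrictScalars K) htop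
      rwa [restrictScalars_adjoin, restrictScalars_top, adjoin_union, adjoin_self, sup_comm] at this
  have hle : extensionEssDim L₀ ≤ Algebra.trdeg K E₀ := by
    unfold extensionEssDim
    exact csInf_le' ⟨E₀, hdef, rfl⟩
  exact hle.trans <| (trdeg_le_of_injective (inclusion hE) (inclusion_injective hE)).trans
    (trdeg_adjoin_simple_le f)

/-- The field `E` in the definition is finite over `E₀`, so such a `g` fixes both `E` and the fixed
field, whose compositum is `L`. -/
theorem IsDefinedOver.eq_one_of_forall_isAlgebraic (hφ : Function.Injective φ)
    {E₀ : IntermediateField K L} (h : IsDefinedOver (fixedField φ.range) E₀) {g : G}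
    (hg : ∀ x : L, IsAlgebraic E₀ x → φ g x = x) : g = 1 := by
  obtain ⟨-, E, hE, hrank, htop⟩ := h
  rw [relfinrank_eq_finrank_of_le hE, finrank_fixedField_range hφ] at hrank
  -- The rank is `|G| > 0`, so it is not the default value `0` of an infinite extension.
  have hfin : FiniteDimensional E₀ (extendScalars hE) := Module.finite_of_finrank_pos (by
    rw [hrank]
    exact Nat.card_pos)
  have hEg : E ≤ fixedField (Subgroup.zpowers (φ g)) := by
    intro x hx
    have hx' : φ g x = x := hg x
      ((Algebra.IsAlgebraic.isAlgebraic (R := E₀) (⟨x, hx⟩ : extendScalars hE)).algHom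
        (extendScalars hE).val)
    rw [mem_fixedField_iff]
    intro σ hσ
    have : Subgroup.zpowers (φ g) ≤ MulAction.stabilizer (L ≃ₐ[K] L) x :=
      (Subgroup.zpowers_le (H := MulAction.stabilizer (L ≃ₐ[K] L) x)).mpr hx'
    exact this hσ
  have hL₀g : fixedField φ.range ≤ fixedField (Subgroup.zpowers (φ g)) :=
    fixedField_antitone (by
      rw [Subgroup.zpowers_le]
      exact ⟨g, rfl⟩)
  apply hφ
  rw [map_one]
  ext x
  have hx : x ∈ fixedField (Subgroup.zpowers (φ g)) :=
    sup_le hEg hL₀g (htop ▸ mem_top : x ∈ E ⊔ fixedField φ.range)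
  exact (mem_fixedField_iff _ x).mp hx _ (Subgroup.mem_zpowers _)

/-- The algebraic closure of `E₀` replaces the field `E` of the definition, which need not be
`G`-stable; `G` embeds in its automorphism group. -/
theorem IsDefinedOver.card_dvd (hφ : Function.Injective φ)
    {E₀ : IntermediateField K L} (h : IsDefinedOver (fixedField φ.range) E₀) :
    Nat.card G ∣ Nat.card ((algebraicClosure E₀ L).restrictScalars K ≃ₐ[K]
      (algebraicClosure E₀ L).restrictScalars K) := by
  set E := (algebraicClosure E₀ L).restrictScalars K
  have hEmem : ∀ x, x ∈ E ↔ IsAlgebraic E₀ x := fun x ↦ mem_algebraicClosure_iff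
  have hstab : ∀ g, ∀ x ∈ E, φ g x ∈ E := by
    intro g x hx
    rw [hEmem] at hx ⊢
    let σ : L →ₐ[E₀] L := ⟨(φ g : L →+* L), fun x ↦ mem_fixedField_range_iff.mp (h.1 x.2) g⟩
    exact hx.algHom σ
  let ψ : G →* (E →ₐ[K] E) :=
    { toFun g := ((φ g).toAlgHom.comp E.val).codRestrict E.toSubalgebra fun x ↦ hstab g x x.2
      map_one' := by
        ext x
        change φ 1 (x : L) = x
        simp
      map_mul' g h := by
        ext x
        change φ (g * h) (x : L) = φ g (φ h x)
        simp }
  refine Subgroup.card_dvd_of_injective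
    ((AlgEquiv.algHomUnitsEquiv K E).toMonoidHom.comp ψ.toHomUnits) ?_
  rw [injective_iff_map_eq_one]
  intro g hg
  refine h.eq_one_of_forall_isAlgebraic hφ fun x hx ↦ ?_
  have := DFunLike.congr_fun hg (⟨x, (hEmem x).mpr hx⟩ : E)
  exact congrArg Subtype.val this

end FiniteGroup

universe u v w

/-! ### The function field of affine space. -/

section FunField

variable {K : Type u} {V : Type v} [Field K] [AddCommGroup V] [Module K V]

theorem SymmetricAlgebra.ι_injective_of_field :
    Function.Injective (SymmetricAlgebra.ι K V) := by
  rw [injective_iff_map_eq_zero]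
  intro v hv
  rw [← Module.forall_dual_apply_eq_zero_iff K]
  intro f
  rw [← SymmetricAlgebra.lift_ι_apply f v, hv, map_zero]

theorem CoordRing.exists_algEquiv_mvPolynomial :
    ∃ σ : Type (max u v), Nonempty (CoordRing K V ≃ₐ[K] MvPolynomial σ K) :=
  ⟨_, ⟨SymmetricAlgebra.equivMvPolynomial (Module.Basis.ofVectorSpace K (Module.Dual K V))⟩⟩

instance CoordRing.instIsIntegrallyClosed : IsIntegrallyClosed (CoordRing K V) := by
  obtain ⟨σ, ⟨e⟩⟩ := CoordRing.exists_algEquiv_mvPolynomial (K := K) (V := V)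
  exact IsIntegrallyClosed.of_equiv e.symm.toRingEquiv

theorem CoordRing.exists_algHom_polynomial_ne_zero (h : CoordRing K V) (hh : h ≠ 0) :
    ∃ c : CoordRing K V →ₐ[K] Polynomial K, c h ≠ 0 := by
  obtain ⟨σ, ⟨e⟩⟩ := CoordRing.exists_algEquiv_mvPolynomial (K := K) (V := V)
  obtain ⟨c, hc⟩ := MvPolynomial.exists_aeval_polynomial_ne_zero
    ((map_ne_zero_iff e e.injective).mpr hh)
  exact ⟨c.comp e.toAlgHom, hc⟩

/-- Such an element is integral over `K[V]`, hence lies in this integrally closed ring, where only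
constants are algebraic. -/
theorem FunField.exists_eq_algebraMap_of_isAlgebraic {x : FunField K V} (hx : IsAlgebraic K x) :
    ∃ a, x = algebraMap K (FunField K V) a := by
  obtain ⟨σ, ⟨e⟩⟩ := CoordRing.exists_algEquiv_mvPolynomial (K := K) (V := V)
  obtain ⟨y, rfl⟩ := IsIntegrallyClosed.isIntegral_iff.mp
    (hx.isIntegral.tower_top : IsIntegral (CoordRing K V) x)
  have hy : IsAlgebraic K y :=
    (isAlgebraic_algebraMap_iff (IsFractionRing.injective (CoordRing K V) (FunField K V))).mp hx
  obtain ⟨a, ha⟩ := MvPolynomial.exists_eq_C_of_isAlgebraic (hy.algHom e.toAlgHom)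
  refine ⟨a, ?_⟩
  rw [IsScalarTower.algebraMap_apply K (CoordRing K V)]
  congr 1
  apply e.injective
  rw [e.commutes]
  exact ha

end FunField

/-! ### Essential dimension of faithful representations. -/

namespace Representation

variable {K : Type u} {G : Type w} {V : Type v} [Field K] [Group G] [AddCommGroup V] [Module K V]
  {ρ : Representation K G V}

theorem coordRingAction_injective (hρ : Function.Injective ρ) :
    Function.Injective ρ.coordRingAction := by
  rw [injective_iff_map_eq_one]
  intro g hg
  have h1 (f : Module.Dual K V) : ρ.dual g f = f := by
    apply SymmetricAlgebra.ι_injective_of_field (K := K)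
    rw [← coordRingHom_ι]
    exact DFunLike.congr_fun hg (SymmetricAlgebra.ι K _ f)
  have h2 : ρ g⁻¹ = 1 := by
    ext v
    rw [Module.End.one_apply, ← sub_eq_zero, ← Module.forall_dual_apply_eq_zero_iff K]
    intro f
    rw [map_sub, sub_eq_zero]
    exact LinearMap.congr_fun (h1 f) v
  rw [← map_one ρ] at h2
  exact inv_eq_one.mp (hρ h2)

theorem funFieldAction_injective (hρ : Function.Injective ρ) :
    Function.Injective ρ.funFieldAction :=
  (IsFractionRing.fieldEquivOfAlgEquivHom_injective K (CoordRing K V) K (FunField K V)).comp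
    (coordRingAction_injective hρ)

variable (ρ) in
theorem exists_isDefinedOver_trdeg_eq_essDim :
    ∃ E₀, IsDefinedOver ρ.invariantField E₀ ∧ ρ.essDim = Algebra.trdeg K E₀ := by
  have : {d | ∃ E₀, IsDefinedOver ρ.invariantField E₀ ∧ d = Algebra.trdeg K E₀}.Nonempty :=
    ⟨_, _, isDefinedOver_self _, rfl⟩
  exact csInf_mem this

/-- If `E₀` were algebraic over `K`, everything algebraic over it would be constant, hence fixed by
all of `G`. -/
theorem one_le_essDim [Finite G] [Nontrivial G] (hρ : Function.Injective ρ) : 1 ≤ ρ.essDim := by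
  rw [Cardinal.one_le_iff_ne_zero]
  intro h0
  obtain ⟨E₀, hE₀, h⟩ := ρ.exists_isDefinedOver_trdeg_eq_essDim
  rw [h0, eq_comm, trdeg_eq_zero_iff] at h
  obtain ⟨g, hg⟩ := exists_ne (1 : G)
  refine hg (hE₀.eq_one_of_forall_isAlgebraic (funFieldAction_injective hρ) fun x hx ↦ ?_)
  obtain ⟨a, rfl⟩ := FunField.exists_eq_algebraMap_of_isAlgebraic (hx.restrictScalars K)
  exact AlgEquiv.commutes _ a

theorem essDim_eq_one_of_injective [Finite G] [Nontrivial G] (hρ : Function.Injective ρ)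
    (a : G → K) (ha : ∀ g h, a (g * h) = a g + a h) (hinj : Function.Injective a) :
    ρ.essDim = 1 :=
  le_antisymm (extensionEssDim_fixedField_le_one (funFieldAction_injective hρ) a ha hinj)
    (one_le_essDim hρ)

theorem card_dvd_of_essDim_eq_one [Finite K] [Finite G] (hρ : Function.Injective ρ)
    (h : ρ.essDim = 1) : Nat.card G ∣ Nat.card (GL (Fin 2) K) := by
  obtain ⟨E₀, hE₀, htr⟩ := ρ.exists_isDefinedOver_trdeg_eq_essDim
  rw [h, eq_comm] at htr
  obtain ⟨e⟩ := exists_algebraicClosure_algEquiv_ratFunc (R := CoordRing K V)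
    CoordRing.exists_algHom_polynomial_ne_zero E₀ htr
  have hdvd := hE₀.card_dvd (funFieldAction_injective hρ)
  rw [Nat.card_congr e.autCongr.toEquiv] at hdvd
  exact hdvd.trans (RatFunc.card_algEquiv_dvd K)

theorem leftRegular_injective (K : Type u) (G : Type w) [Field K] [Group G] :
    Function.Injective (leftRegular K G) := by
  intro g h hgh
  have := LinearMap.congr_fun hgh (MonoidAlgebra.single 1 1)
  rw [ofMulAction_single, ofMulAction_single, MonoidAlgebra.single_left_inj one_ne_zero] at this
  simpa using this

end Representation

/-! ### The order of `GL₂` and the conclusion. -/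

/-- With `q = p ^ n`, the order of `GL₂` is `(q² - 1)(q - 1)q`, in which only the factor `q` is
divisible by `p`. -/
theorem le_of_prime_pow_dvd_card_GL {p : ℕ} [Fact p.Prime] {K : Type*} [Field K] [Finite K]
    {n r : ℕ} (hn : Nat.card K = p ^ n) (h : p ^ r ∣ Nat.card (GL (Fin 2) K)) : r ≤ n := by
  have hp : p.Prime := Fact.out
  have := Fintype.ofFinite K
  have hn0 : n ≠ 0 := by
    rintro rfl
    have := Finite.one_lt_card (α := K)
    rw [hn] at this
    simp at this
  rw [Matrix.card_GL_field, Fin.prod_univ_two, ← Nat.card_eq_fintype_card, hn] at h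
  have hco (m : ℕ) (hm : m ≠ 0) : (p ^ r).Coprime (p ^ m - 1) := by
    refine Nat.Coprime.pow_left _ ((hp.coprime_iff_not_dvd).mpr fun hd ↦ ?_)
    have h1 : 1 ≤ p ^ m := Nat.one_le_pow _ _ hp.pos
    have := (Nat.dvd_sub_iff_right h1 (dvd_pow_self p hm)).mp hd
    exact hp.one_lt.ne' (Nat.dvd_one.mp this)
  have hfac : ((p ^ n) ^ 2 - (p ^ n) ^ ((0 : Fin 2) : ℕ)) *
      ((p ^ n) ^ 2 - (p ^ n) ^ ((1 : Fin 2) : ℕ)) =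
      (p ^ (n * 2) - 1) * ((p ^ n - 1) * p ^ n) := by
    rw [← pow_mul]
    simp [Nat.sub_mul, ← pow_add, mul_two]
  rw [hfac] at h
  have := (hco n hn0).dvd_of_dvd_mul_left ((hco (n * 2) (by omega)).dvd_of_dvd_mul_left h)
  exact (Nat.pow_dvd_pow_iff_le_right hp.one_lt).mp this

theorem essDim_eq_one_iff {p : ℕ} [Fact p.Prime] {K : Type*} [Field K] [CharP K p]
    [Algebra (ZMod p) K] {r : ℕ} (hr : 0 < r) {V : Type*} [AddCommGroup V] [Module K V]
    (ρ : Representation K (Multiplicative (Fin r → ZMod p)) V) (hρ : Function.Injective ρ) :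
    ρ.essDim = 1 ↔ (r : Cardinal) ≤ Module.rank (ZMod p) K := by
  have : Nonempty (Fin r) := ⟨⟨0, hr⟩⟩
  constructor
  · intro h
    by_contra! hlt
    have hfin : Module.Finite (ZMod p) K :=
      Module.rank_lt_aleph0_iff.mp (hlt.trans Cardinal.natCast_lt_aleph0)
    have : Finite K := Module.finite_of_finite (ZMod p)
    have hdvd := Representation.card_dvd_of_essDim_eq_one hρ h
    have hG : Nat.card (Multiplicative (Fin r → ZMod p)) = p ^ r := by
      rw [Nat.card_congr Multiplicative.toAdd]
      simp
    rw [hG] at hdvd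
    have hK : Nat.card K = p ^ Module.finrank (ZMod p) K := by
      rw [Module.natCard_eq_pow_finrank (K := ZMod p), Nat.card_zmod]
    have hle := le_of_prime_pow_dvd_card_GL hK hdvd
    rw [← Module.finrank_eq_rank, Nat.cast_lt] at hlt
    omega
  · intro h
    -- The rank bound yields an injective `F_p`-linear map from `G`, written additively, to `K`.
    obtain ⟨a, ha⟩ := Module.le_rank_iff_exists_linearMap.mp h
    exact ρ.essDim_eq_one_of_injective hρ (fun g ↦ a g.toAdd) (fun g h ↦ by simp)
      (ha.comp Multiplicative.toAdd.injective)

theorem proposition5p10 {p : ℕ} [Fact p.Prime] {K : Type*} [Field K] [CharP K p]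
    (r : ℕ) (hr : 0 < r) :
    letI : Algebra (ZMod p) K := ZMod.algebra K p
    (groupEssDim K (Multiplicative (Fin r → ZMod p)) = 1 ↔
      (r : Cardinal) ≤ Module.rank (ZMod p) K) ∧
    -- The same holds when `ed_K(G)` is computed from any other faithful representation of `G`.
    ∀ (V : Type*) [AddCommGroup V] [Module K V] [FiniteDimensional K V]
      (ρ : Representation K (Multiplicative (Fin r → ZMod p)) V), Function.Injective ρ →
      (ρ.essDim = 1 ↔ (r : Cardinal) ≤ Module.rank (ZMod p) K) := by
  let : Algebra (ZMod p) K := ZMod.algebra K p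
  exact ⟨essDim_eq_one_iff hr _ (Representation.leftRegular_injective K _),
    fun V _ _ _ ρ hρ ↦ essDim_eq_one_iff hr ρ hρ⟩
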